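/- Let $\mathbb H$ be the real quaternions. Ranks of quaternion matrices are dimensions of right column spaces, and $\operatorname{Ind}(B)$, for a square matrix $B$, is the least integer $k\ge 0$ with $\operatorname{rank}B^{k+1}=\operatorname{rank}B^{k}$. For a $p\times p$ quaternion matrix $B=(b_{st})$, with rows and columns indexed by a linearly ordered set, and an index $i$, the $i$-th column determinant is $$\operatorname{cdet}_i B=\sum_{\sigma}\operatorname{sgn}(\sigma)\;C_\sigma(c_l)\cdots C_\sigma(c_2)\,C_\sigma(i),\qquad C_\sigma(c)=b_{c\,\sigma(c)}\,b_{\sigma(c)\,\sigma^2(c)}\cdots b_{\sigma^{-1}(c)\,c},$$ where $\sigma$ runs over the permutations of the index set and $c_2<\dots<c_l$ are the least elements of the cycles of $\sigma$ (fixed points included) that do not contain $i$. If $B$ is Hermitian, all $\operatorname{cdet}_iB$ are equal, and $\det B$ denotes their common value; the determinant of the empty matrix is $1$. Write $B_\beta^\beta$ for the principal submatrix on the rows and columns in $\beta$, $B_{.i}(b)$ for $B$ with its $i$-th column replaced by $b$, $J_{r,m}$ for the set of $r$-element subsets of $\{1,\dots,m\}$, and $J_{r,m}\{i\}$ for the set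 of those that contain $i$. **Theorem.** Let $A\in\mathbb H^{m\times n}$ and $W\in\mathbb H^{n\times m}$ be such that $AW$ is Hermitian. Let $k=\max\{\operatorname{Ind}(AW),\operatorname{Ind}(WA)\}$ and $\operatorname{rank}(AW)^{k+1}=\operatorname{rank}(AW)^k=r$. Then the $W$-weighted Drazin inverse $A_{d,W}=(a^{d,W}_{ij})\in\mathbb H^{m\times n}$ of $A$, that is, the unique matrix $X$ satisfying $$(AW)^{k+1}XW=(AW)^k,\qquad XWAWX=X,\qquad AWX=XWA,$$ exists, and for all $1\le i\le m$ and $1\le j\le n$ $$a^{d,W}_{ij}=\frac{\displaystyle\sum_{\beta\in J_{r,m}\{i\}}\operatorname{cdet}_i\Big(\big((AW)^{k+2}\big)_{.i}\big(\bar v_{.j}\big)\Big)_\beta^\beta}{\displaystyle\sum_{\beta\in J_{r,m}}\det\Big((AW)^{k+2}\Big)_\beta^\beta},$$ where $\bar v_{.j}$ is the $j$-th column of $(AW)^kA$, and the denominator is nonzero. -/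

import Mathlib

namespace QMat

section Determinants

variable {R : Type*} [Ring R] {ι : Type*} [Fintype ι] [LinearOrder ι]

/-- The ordered product `a_{c,σ c} a_{σ c,σ² c} ⋯ a_{σ⁻¹ c,c}` along the cycle of `σ` through `c`
(it is `a_{c,c}` when `c` is a fixed point). -/
noncomputable def cycleProd (A : Matrix ι ι R) (σ : Equiv.Perm ι) (c : ι) : R :=
  ((List.range (Function.minimalPeriod σ c)).map
    fun t => A ((σ ^ t) c) ((σ ^ (t + 1)) c)).prod

/-- The least elements of those cycles of `σ` (fixed points included) that do not contain `j`,
listed in decreasing order. -/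
def otherCycleMins (σ : Equiv.Perm ι) (j : ι) : List ι :=
  (Finset.univ.filter fun c => ¬ σ.SameCycle j c ∧ ∀ d, σ.SameCycle c d → c ≤ d).sort
    (· ≥ ·)

/-- The `j`-th column determinant: the alternating sum over all permutations `σ` of the products
of the entries of `A` along the cycles of `σ`, in which the cycle through `j` is started at `j` and
written rightmost, every other cycle is started at its least element, and these least elements
increase from right to left. The sign `(-1)^(n - number of cycles)` is the sign of `σ`. -/
noncomputable def cdet (j : ι) (A : Matrix ι ι R) : R :=
  ∑ σ : Equiv.Perm ι, ((Equiv.Perm.sign σ : ℤ) : R) *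
    (((otherCycleMins σ j).map (cycleProd A σ)).prod * cycleProd A σ j)

/-- The determinant of a Hermitian quaternion matrix, for which all column (and row) determinants
coincide: the column determinant at the least index. The determinant of the empty matrix is `1`. -/
noncomputable def hdet (A : Matrix ι ι R) : R :=
  if h : (Finset.univ : Finset ι).Nonempty then cdet (Finset.univ.min' h) A else 1

/-- The principal submatrix of `A` on the rows and columns indexed by `β`. -/
def principal (A : Matrix ι ι R) (β : Finset ι) : Matrix β β R :=
  A.submatrix Subtype.val Subtype.val

end Determinants

/-- The rank of a quaternion matrix: the dimension of its right column space, that is of the span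
of its columns for multiplication by scalars from the right. -/
noncomputable def rank {m n : ℕ} (A : Matrix (Fin m) (Fin n) (Quaternion ℝ)) : ℕ :=
  Module.finrank (Quaternion ℝ)ᵐᵒᵖ
    (Submodule.span (Quaternion ℝ)ᵐᵒᵖ (Set.range fun j : Fin n => fun i : Fin m => A i j))

/-- The index of a square matrix: the least `k ≥ 0` with `rank A^(k+1) = rank A^k`. -/
noncomputable def index {n : ℕ} (A : Matrix (Fin n) (Fin n) (Quaternion ℝ)) : ℕ :=
  sInf {k : ℕ | rank (A ^ (k + 1)) = rank (A ^ k)}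

/-- The defining equations of the `W`-weighted Drazin inverse `X` of `A`. -/
structure IsWeightedDrazin {m n : ℕ} (A : Matrix (Fin m) (Fin n) (Quaternion ℝ))
    (W : Matrix (Fin n) (Fin m) (Quaternion ℝ)) (X : Matrix (Fin m) (Fin n) (Quaternion ℝ)) :
    Prop where
  pow_mul : (A * W) ^ (max (index (A * W)) (index (W * A)) + 1) * X * W =
    (A * W) ^ max (index (A * W)) (index (W * A))
  outer : X * W * A * W * X = X
  comm : A * W * X = X * W * A

end QMat

/-! Write `H = A * W`. Being Hermitian, `H` has a group inverse `G`: it commutes with `H`, and `H G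
H = H`, `G H G = G`. The defining equations force `X W = G`, hence `X = G G A`, and `G G A`
satisfies them. It remains to express `G G A` by column determinants of `M = H ^ (k + 2)`.

The tool is a Faddeev–LeVerrier recursion. Let `d_q` be the sum of the principal minors of `M` of
order `q`, and `R_q` the matrix of summed column-determinant cofactors (`adjSum`). Then `R_(q+1) =
d_q - R_q M` (`adjSum_succ`). If `s` is the largest `q` with `d_q ≠ 0`, then `R_(s+1) M ^ t = 0` for
large `t`, hence `R_(s+1) M = 0` because `M` is Hermitian, that is, `R_s M M = d_s M`. So `R_s M =
d_s H G`, and comparing `Re tr (R_s M) = s d_s` with `Re tr (H G) = rank (H G)` gives `s = r`. As `H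
^ k = M G G`, this yields `R_r H ^ k A = d_r G G A`, the asserted formula.

The recursion rests on row expansion (`cdetAux_succ`). It is run with the products over the other
cycles replaced by their real parts: there scalars commute, and pairing `σ` with `σ⁻¹` shows that
the determinant is real and the same for all columns. For Hermitian matrices this version agrees
with the genuine one (`hdetAux_cdetAux_principal`). -/

namespace QMat

open Equiv

/-! ### Inserting a point into a cycle of a permutation -/

section Insertion

theorem pow_minimalPeriod_apply {α : Type*} (σ : Perm α) (b : α) :
    (σ ^ Function.minimalPeriod σ b) b = b := by
  rw [← Perm.iterate_eq_pow]
  exact Function.isPeriodicPt_minimalPeriod σ b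

theorem minimalPeriod_pos {α : Type*} [Finite α] (σ : Perm α) (b : α) :
    0 < Function.minimalPeriod σ b := by
  apply Function.minimalPeriod_pos_of_mem_periodicPts
  refine ⟨orderOf σ, orderOf_pos σ, ?_⟩
  rw [Function.IsPeriodicPt, Function.IsFixedPt, Perm.iterate_eq_pow, pow_orderOf_eq_one,
    Perm.one_apply]

variable {α ι : Type*} [LinearOrder α]

/-- The permutation of `ι` obtained from a permutation `σ` of `α` by inserting the additional point
`e none` right before `x` in its cycle, or as a fixed point when `x = none`. -/
def insertPerm (e : Option α ≃ ι) (x : Option α) (σ : Perm α) : Perm ι :=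
  e.permCongr (swap none x * optionCongr σ)

theorem sum_perm_eq_sum_insertPerm {M : Type*} [AddCommMonoid M] [Fintype α] [Fintype ι]
    [DecidableEq ι] (e : Option α ≃ ι) (f : Perm ι → M) :
    ∑ τ, f τ = ∑ σ, f (insertPerm e none σ) + ∑ b, ∑ σ, f (insertPerm e (some b) σ) := by
  rw [← (Perm.decomposeOption.symm.trans e.permCongr).sum_comp f, Fintype.sum_prod_type,
    Fintype.sum_option]
  rfl

variable (e : Option α ≃ ι) (σ : Perm α)

theorem insertPerm_apply_none (x : Option α) : insertPerm e x σ (e none) = e x := by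
  simp [insertPerm, Equiv.permCongr_apply]

theorem insertPerm_none_apply_some (a : α) :
    insertPerm e none σ (e (some a)) = e (some (σ a)) := by
  simp [insertPerm, Equiv.permCongr_apply]

theorem insertPerm_some_apply_of_eq {b a : α} (h : σ a = b) :
    insertPerm e (some b) σ (e (some a)) = e none := by
  simp [insertPerm, Equiv.permCongr_apply, h]

theorem insertPerm_some_apply_of_ne {b a : α} (h : σ a ≠ b) :
    insertPerm e (some b) σ (e (some a)) = e (some (σ a)) := by
  simp [insertPerm, Equiv.permCongr_apply]
  rw [swap_apply_of_ne_of_ne] <;> simp [h]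

theorem sign_insertPerm_none [Fintype α] [Fintype ι] [DecidableEq ι] :
    Perm.sign (insertPerm e none σ) = Perm.sign σ := by
  simp [insertPerm, Equiv.optionCongr_sign]

theorem sign_insertPerm_some [Fintype α] [Fintype ι] [DecidableEq ι] (b : α) :
    Perm.sign (insertPerm e (some b) σ) = -Perm.sign σ := by
  simp [insertPerm, Equiv.optionCongr_sign]

theorem insertPerm_none_pow (a : α) (t : ℕ) :
    (insertPerm e none σ ^ t) (e (some a)) = e (some ((σ ^ t) a)) := by
  induction t with
  | zero => simp
  | succ t ih => rw [pow_succ', Perm.mul_apply, ih, insertPerm_none_apply_some, pow_succ',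
      Perm.mul_apply]

theorem insertPerm_some_pow {a b : α} (h : ¬ σ.SameCycle b a) (t : ℕ) :
    (insertPerm e (some b) σ ^ t) (e (some a)) = e (some ((σ ^ t) a)) := by
  induction t with
  | zero => simp
  | succ t ih =>
    rw [pow_succ', Perm.mul_apply, ih, pow_succ', Perm.mul_apply, insertPerm_some_apply_of_ne]
    intro hb
    apply h
    rw [← hb]
    exact Perm.SameCycle.symm ⟨(t + 1 : ℕ), by rw [zpow_natCast, pow_succ', Perm.mul_apply]⟩

theorem insertPerm_some_pow_none {b : α} {t : ℕ} (ht : t < Function.minimalPeriod σ b) :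
    (insertPerm e (some b) σ ^ (t + 1)) (e none) = e (some ((σ ^ t) b)) := by
  induction t with
  | zero => simp [insertPerm_apply_none]
  | succ t ih =>
    rw [pow_succ', Perm.mul_apply, ih (by omega), insertPerm_some_apply_of_ne, pow_succ' σ,
      Perm.mul_apply]
    intro hb
    have : Function.IsPeriodicPt σ (t + 1) b := by
      rw [Function.IsPeriodicPt, Function.IsFixedPt, Perm.iterate_eq_pow, pow_succ', Perm.mul_apply]
      exact hb
    have := this.minimalPeriod_le (by omega)
    omega

theorem insertPerm_some_pow_period [Finite α] (b : α) :
    (insertPerm e (some b) σ ^ (Function.minimalPeriod σ b + 1)) (e none) = e none := by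
  obtain ⟨p, hp⟩ := Nat.exists_eq_succ_of_ne_zero (minimalPeriod_pos σ b).ne'
  have h := pow_minimalPeriod_apply σ b
  rw [hp, Nat.succ_eq_add_one, pow_succ', Perm.mul_apply] at h
  rw [hp, Nat.succ_eq_add_one, pow_succ', Perm.mul_apply,
    insertPerm_some_pow_none e σ (by omega), insertPerm_some_apply_of_eq _ _ h]

theorem minimalPeriod_insertPerm_some [Finite α] (b : α) :
    Function.minimalPeriod (insertPerm e (some b) σ) (e none) =
      Function.minimalPeriod σ b + 1 := by
  apply le_antisymm
  · apply Function.IsPeriodicPt.minimalPeriod_le (by omega)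
    rw [Function.IsPeriodicPt, Function.IsFixedPt, Perm.iterate_eq_pow,
      insertPerm_some_pow_period]
  · by_contra! hlt
    obtain ⟨q, hq⟩ | hq : (∃ q, Function.minimalPeriod (insertPerm e (some b) σ) (e none) = q + 1) ∨
        Function.minimalPeriod (insertPerm e (some b) σ) (e none) = 0 := by
      rcases Nat.eq_zero_or_eq_succ_pred
        (Function.minimalPeriod (insertPerm e (some b) σ) (e none)) with h | h
      · exact Or.inr h
      · exact Or.inl ⟨_, h⟩
    · have h := Function.isPeriodicPt_minimalPeriod (insertPerm e (some b) σ) (e none)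
      rw [hq, Function.IsPeriodicPt, Function.IsFixedPt, Perm.iterate_eq_pow,
        insertPerm_some_pow_none e σ (by omega)] at h
      simp at h
    -- `minimalPeriod` is `0` at non-periodic points, so this value is excluded separately.
    · have h : (0 : ℕ) < Function.minimalPeriod (insertPerm e (some b) σ) (e none) := by
        apply Function.minimalPeriod_pos_of_mem_periodicPts
        refine ⟨Function.minimalPeriod σ b + 1, by omega, ?_⟩
        rw [Function.IsPeriodicPt, Function.IsFixedPt, Perm.iterate_eq_pow,
          insertPerm_some_pow_period]
      omega

theorem sameCycle_insertPerm_none (a c : α) :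
    (insertPerm e none σ).SameCycle (e (some a)) (e (some c)) ↔ σ.SameCycle a c := by
  have key : ∀ i : ℤ, (insertPerm e none σ ^ i) (e (some a)) = e (some ((σ ^ i) a)) := by
    intro i
    have hinv : ∀ (t : ℕ), ((insertPerm e none σ)⁻¹ ^ t) (e (some a)) = e (some ((σ⁻¹ ^ t) a)) := by
      intro t
      rw [inv_pow, inv_pow, Perm.inv_eq_iff_eq, insertPerm_none_pow, ← Perm.mul_apply,
        mul_inv_cancel, Perm.one_apply]
    cases i with
    | ofNat t => simpa using insertPerm_none_pow e σ a t
    | negSucc t => rw [zpow_negSucc, zpow_negSucc, ← inv_pow, ← inv_pow, hinv]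
  simp [Perm.SameCycle, key]

theorem not_sameCycle_insertPerm_none (a : α) :
    ¬ (insertPerm e none σ).SameCycle (e none) (e (some a)) := by
  rintro ⟨i, hi⟩
  rw [Perm.zpow_apply_eq_self_of_apply_eq_self (insertPerm_apply_none e σ none)] at hi
  simp at hi

/-- The new point joins the cycle of `b`; collapsing it onto `b`, as `getD b` does, turns the new
cycles into those of `σ`. -/
theorem sameCycle_insertPerm_some_iff (b : α) (x y : Option α) :
    (insertPerm e (some b) σ).SameCycle (e x) (e y) ↔ σ.SameCycle (x.getD b) (y.getD b) := by
  have step : ∀ a, (insertPerm e (some b) σ).SameCycle (e (some a)) (e (some (σ a))) := by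
    intro a
    by_cases h : σ a = b
    · refine ⟨2, ?_⟩
      rw [show (2 : ℤ) = 1 + 1 from rfl, zpow_add, zpow_one, Perm.mul_apply,
        insertPerm_some_apply_of_eq _ _ h, insertPerm_apply_none, h]
    · exact ⟨1, by rw [zpow_one, insertPerm_some_apply_of_ne _ _ h]⟩
  have hnone : ∀ x : Option α,
      (insertPerm e (some b) σ).SameCycle (e x) (e (some (x.getD b))) := by
    rintro (_ | a)
    · exact ⟨1, by rw [zpow_one, insertPerm_apply_none]; rfl⟩
    · exact Perm.SameCycle.refl _ _
  have lift : ∀ a c, σ.SameCycle a c →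
      (insertPerm e (some b) σ).SameCycle (e (some a)) (e (some c)) := by
    rintro a c ⟨i, rfl⟩
    induction i using Int.induction_on with
    | zero => exact Perm.SameCycle.refl _ _
    | succ i ih =>
      refine ih.trans ?_
      rw [add_comm, zpow_add, zpow_one, Perm.mul_apply]
      exact step _
    | pred i ih =>
      refine ih.trans ?_
      have := step ((σ ^ (-(i : ℤ) - 1)) a)
      rw [← Perm.mul_apply, ← zpow_one_add, show 1 + (-(i : ℤ) - 1) = -i by ring] at this
      exact this.symm
  have down1 : ∀ x : Option α, σ.SameCycle (x.getD b)
      ((e.symm (insertPerm e (some b) σ (e x))).getD b) := by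
    rintro (_ | a)
    · rw [insertPerm_apply_none]; simp [Perm.SameCycle.refl]
    · by_cases h : σ a = b
      · rw [insertPerm_some_apply_of_eq _ _ h]
        simp only [Option.getD_some, Equiv.symm_apply_apply, Option.getD_none]
        exact ⟨1, by simpa using h⟩
      · rw [insertPerm_some_apply_of_ne _ _ h]
        simp only [Option.getD_some, Equiv.symm_apply_apply]
        exact ⟨1, by simp⟩
  have down : ∀ i : ℤ, ∀ x : Option α, σ.SameCycle (x.getD b)
      ((e.symm ((insertPerm e (some b) σ ^ i) (e x))).getD b) := by
    intro i x
    induction i using Int.induction_on with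
    | zero => simp [Perm.SameCycle.refl]
    | succ i ih =>
      refine ih.trans ?_
      have := down1 (e.symm ((insertPerm e (some b) σ ^ (i : ℤ)) (e x)))
      rwa [Equiv.apply_symm_apply, ← Perm.mul_apply, ← zpow_one_add, add_comm] at this
    | pred i ih =>
      refine ih.trans ?_
      have := down1 (e.symm ((insertPerm e (some b) σ ^ (-(i : ℤ) - 1)) (e x)))
      rw [Equiv.apply_symm_apply, ← Perm.mul_apply, ← zpow_one_add,
        show 1 + (-(i : ℤ) - 1) = -i by ring] at this
      exact this.symm
  constructor
  · rintro ⟨i, hi⟩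
    have := down i x
    rwa [hi, Equiv.symm_apply_apply] at this
  · intro h
    exact (hnone x).trans ((lift _ _ h).trans (hnone y).symm)

end Insertion

/-! ### Least elements of cycles under insertion -/

section CycleData

variable {α ι : Type*} [LinearOrder α] [Fintype α] [LinearOrder ι] [Fintype ι]

/-- The least elements of all cycles of `σ`, in decreasing order. -/
def cycleMins (σ : Perm α) : List α :=
  (Finset.univ.filter fun c => ∀ d, σ.SameCycle c d → c ≤ d).sort (· ≥ ·)

/-- Monotonicity is needed on the old points only: the cycle of the new point is not listed, so that
point may sit anywhere in the order. This permits expansion at every index. -/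
theorem otherCycleMins_insertPerm_none (e : Option α ≃ ι) (he : StrictMono fun a => e (some a))
    (σ : Perm α) :
    otherCycleMins (insertPerm e none σ) (e none) =
      (cycleMins σ).map fun a => e (some a) := by
  have := Finset.map_sort ⟨fun a => e (some a), he.injective⟩
    (Finset.univ.filter fun c => ∀ d, σ.SameCycle c d → c ≤ d) (· ≥ ·) (· ≥ ·)
    (fun a _ b _ => (he.le_iff_le).symm)
  rw [cycleMins]
  refine Eq.trans ?_ this.symm
  rw [otherCycleMins]
  congr 1
  ext c
  obtain ⟨x, rfl⟩ := e.surjective c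
  simp only [Finset.mem_filter, Finset.mem_univ, true_and, Finset.mem_map,
    Function.Embedding.coeFn_mk]
  cases x with
  | none => simp [Perm.SameCycle.refl]
  | some a =>
    simp only [EmbeddingLike.apply_eq_iff_eq, Option.some.injEq, exists_eq_right,
      not_sameCycle_insertPerm_none, not_false_eq_true, true_and]
    rw [← e.forall_congr_right, Option.forall]
    constructor
    · rintro ⟨-, h⟩ d hd
      exact he.le_iff_le.1 (h d ((sameCycle_insertPerm_none e σ _ _).2 hd))
    · intro h
      refine ⟨fun h' => absurd h'.symm (not_sameCycle_insertPerm_none e σ a), fun d hd => ?_⟩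
      exact he.le_iff_le.2 (h d ((sameCycle_insertPerm_none e σ _ _).1 hd))

theorem otherCycleMins_insertPerm_some (e : Option α ≃ ι) (he : StrictMono fun a => e (some a))
    (σ : Perm α) (b : α) :
    otherCycleMins (insertPerm e (some b) σ) (e none) =
      (otherCycleMins σ b).map fun a => e (some a) := by
  have := Finset.map_sort ⟨fun a => e (some a), he.injective⟩
    (Finset.univ.filter fun c => ¬ σ.SameCycle b c ∧ ∀ d, σ.SameCycle c d → c ≤ d) (· ≥ ·) (· ≥ ·)
    (fun a _ b _ => (he.le_iff_le).symm)
  rw [otherCycleMins, otherCycleMins]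
  refine Eq.trans ?_ this.symm
  congr 1
  ext c
  obtain ⟨x, rfl⟩ := e.surjective c
  simp only [Finset.mem_filter, Finset.mem_univ, true_and, Finset.mem_map,
    Function.Embedding.coeFn_mk]
  cases x with
  | none => simp [Perm.SameCycle.refl]
  | some a =>
    simp only [EmbeddingLike.apply_eq_iff_eq, Option.some.injEq, exists_eq_right,
      sameCycle_insertPerm_some_iff, Option.getD_none, Option.getD_some]
    refine and_congr_right fun hba => ?_
    rw [← e.forall_congr_right, Option.forall]
    simp only [sameCycle_insertPerm_some_iff, Option.getD_none, Option.getD_some]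
    constructor
    · rintro ⟨-, h⟩ d hd
      exact he.le_iff_le.1 (h d hd)
    · intro h
      exact ⟨fun h' => absurd h'.symm hba, fun d hd => he.le_iff_le.2 (h d hd)⟩

end CycleData

/-! ### Cycle products under insertion -/

section CycleProd

variable {R : Type*} [Ring R] {α ι : Type*}

theorem cycleProd_congr {τ : Perm ι} {σ : Perm α} {f : α → ι} (hf : Function.Injective f) {c : α}
    (h : ∀ t : ℕ, (τ ^ t) (f c) = f ((σ ^ t) c)) {B : Matrix ι ι R} {A : Matrix α α R}
    (hAB : ∀ t : ℕ, B (f ((σ ^ t) c)) (f ((σ ^ (t + 1)) c)) = A ((σ ^ t) c) ((σ ^ (t + 1)) c)) :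
    cycleProd B τ (f c) = cycleProd A σ c := by
  have hp : Function.minimalPeriod τ (f c) = Function.minimalPeriod σ c := by
    rw [Function.minimalPeriod_eq_minimalPeriod_iff]
    intro n
    rw [Function.IsPeriodicPt, Function.IsPeriodicPt, Function.IsFixedPt, Function.IsFixedPt,
      Perm.iterate_eq_pow, Perm.iterate_eq_pow, h, hf.eq_iff]
  simp only [cycleProd, hp, h, hAB]

variable [LinearOrder α]

theorem cycleProd_insertPerm_none (e : Option α ≃ ι) (σ : Perm α) (A : Matrix ι ι R) (c : α) :
    cycleProd A (insertPerm e none σ) (e (some c)) =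
      cycleProd (A.submatrix (fun a => e (some a)) fun a => e (some a)) σ c :=
  cycleProd_congr (f := fun a => e (some a)) (fun _ _ h => by simpa using h)
    (insertPerm_none_pow e σ c) (fun _ => rfl)

theorem cycleProd_insertPerm_some (e : Option α ≃ ι) (σ : Perm α) (A : Matrix ι ι R) {b c : α}
    (h : ¬ σ.SameCycle b c) :
    cycleProd A (insertPerm e (some b) σ) (e (some c)) =
      cycleProd (A.submatrix (fun a => e (some a)) fun a => e (some a)) σ c :=
  cycleProd_congr (f := fun a => e (some a)) (fun _ _ h => by simpa using h)
    (insertPerm_some_pow e σ h) (fun _ => rfl)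

theorem cycleProd_updateCol_insertPerm_none [DecidableEq ι] (e : Option α ≃ ι) (σ : Perm α)
    (A : Matrix ι ι R)
    (v : ι → R) :
    cycleProd (A.updateCol (e none) v) (insertPerm e none σ) (e none) = v (e none) := by
  have : Function.minimalPeriod (insertPerm e none σ) (e none) = 1 := by
    rw [Function.minimalPeriod_eq_one_iff_isFixedPt]
    exact insertPerm_apply_none e σ none
  simp [cycleProd, this, insertPerm_apply_none]

/-- The step from the new point to `b` splits off on the left. The closing step, which reads `v`,
becomes the step back to `b`, so `v` moves into column `b` of the smaller matrix. -/
theorem cycleProd_updateCol_insertPerm_some [Finite α] [DecidableEq ι] (e : Option α ≃ ι)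
    (σ : Perm α) (A : Matrix ι ι R)
    (v : ι → R) (b : α) :
    cycleProd (A.updateCol (e none) v) (insertPerm e (some b) σ) (e none) =
      A (e none) (e (some b)) *
        cycleProd ((A.submatrix (fun a => e (some a)) fun a => e (some a)).updateCol b
          fun a => v (e (some a))) σ b := by
  rw [cycleProd, minimalPeriod_insertPerm_some, List.range_succ_eq_map, List.map_cons,
    List.prod_cons, List.map_map]
  congr 1
  · simp [insertPerm_apply_none]
  · rw [cycleProd]
    congr 1
    refine List.map_congr_left fun t ht => ?_
    rw [List.mem_range] at ht
    simp only [Function.comp_apply, Nat.succ_eq_add_one]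
    rw [insertPerm_some_pow_none e σ ht]
    rcases Nat.lt_or_ge (t + 1) (Function.minimalPeriod σ b) with h | h
    · rw [insertPerm_some_pow_none e σ h, Matrix.updateCol_ne (by simp), Matrix.updateCol_ne]
      · rfl
      · intro hb
        have : Function.IsPeriodicPt σ (t + 1) b := by
          rwa [Function.IsPeriodicPt, Function.IsFixedPt, Perm.iterate_eq_pow]
        have := this.minimalPeriod_le (by omega)
        omega
    · have h' : t + 1 = Function.minimalPeriod σ b := by omega
      rw [h', insertPerm_some_pow_period, pow_minimalPeriod_apply, Matrix.updateCol_self,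
        Matrix.updateCol_self]

end CycleProd

end QMat

namespace QMat

open Equiv

/-! ### Inverse permutations and conjugation -/

section Cycles

variable {ι : Type*}

theorem sameCycle_pow_right (σ : Perm ι) (c : ι) (t : ℕ) : σ.SameCycle c ((σ ^ t) c) :=
  ⟨t, by simp⟩

theorem minimalPeriod_inv (σ : Perm ι) (c : ι) :
    Function.minimalPeriod ⇑σ⁻¹ c = Function.minimalPeriod σ c := by
  rw [Function.minimalPeriod_eq_minimalPeriod_iff]
  intro n
  rw [Function.IsPeriodicPt, Function.IsPeriodicPt, Function.IsFixedPt, Function.IsFixedPt,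
    Perm.iterate_eq_pow, Perm.iterate_eq_pow, inv_pow, Perm.inv_eq_iff_eq, eq_comm]

theorem cycleProd_updateCol_of_not_sameCycle {R : Type*} [Ring R] [DecidableEq ι]
    (A : Matrix ι ι R) {σ : Perm ι} {j c : ι} (v : ι → R)
    (h : ¬ σ.SameCycle j c) : cycleProd (A.updateCol j v) σ c = cycleProd A σ c := by
  refine cycleProd_congr (f := id) Function.injective_id (fun _ => rfl) fun t => ?_
  rw [Matrix.updateCol_ne]
  · rfl
  · rintro h'
    exact h (h' ▸ (sameCycle_pow_right σ c (t + 1)).symm)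

/-- Running a cycle backwards reverses the factors and, by Hermitian symmetry, conjugates each of
them. -/
theorem cycleProd_inv {A : Matrix ι ι (Quaternion ℝ)} (hA : A.IsHermitian) (σ : Perm ι) (c : ι) :
    cycleProd A σ⁻¹ c = star (cycleProd A σ c) := by
  have hstar : ∀ l : List (Quaternion ℝ), star l.prod = (l.map star).reverse.prod := by
    intro l
    induction l with
    | nil => simp
    | cons a l ih => simp [ih]
  rw [cycleProd, cycleProd, minimalPeriod_inv, hstar]
  congr 1
  apply List.ext_getElem
  · simp
  · intro t h1 h2
    simp only [List.length_map, List.length_range] at h1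
    simp only [List.getElem_map, List.getElem_range, List.getElem_reverse, List.length_map,
      List.length_range]
    have key : ∀ s ≤ Function.minimalPeriod σ c,
        (σ⁻¹ ^ s) c = (σ ^ (Function.minimalPeriod σ c - s)) c := by
      intro s hs
      rw [inv_pow, Perm.inv_eq_iff_eq, ← Perm.mul_apply, ← pow_add, Nat.add_sub_cancel' hs,
        pow_minimalPeriod_apply]
    rw [key t h1.le, key (t + 1) h1, ← hA.apply]
    have e1 : Function.minimalPeriod σ c - 1 - t = Function.minimalPeriod σ c - (t + 1) := by omega
    have e2 : Function.minimalPeriod σ c - (t + 1) + 1 = Function.minimalPeriod σ c - t := by omega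
    rw [e1, e2]

end Cycles

/-! ### Row expansion of column determinants -/

section Expansion

variable {R : Type*} [Ring R] {α ι : Type*} [LinearOrder α] [Fintype α] [LinearOrder ι] [Fintype ι]

/-- The alternating sum over all permutations of the products over all cycles, started at their least
elements and ordered decreasingly, after the cycle products have been transformed by `g`. -/
noncomputable def hdetAux (g : R → R) (A : Matrix ι ι R) : R :=
  ∑ σ : Perm ι, ((Perm.sign σ : ℤ) : R) * ((cycleMins σ).map fun c => g (cycleProd A σ c)).prod

/-- The `j`-th column determinant of `A` with the `j`-th column replaced by `v`, in which the products
over the cycles not containing `j` are transformed by `g`, and `u` is inserted to the left of the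
product over the cycle containing `j`. -/
noncomputable def cdetAux (g : R → R) (A : Matrix ι ι R) (j : ι) (u : R) (v : ι → R) : R :=
  ∑ σ : Perm ι, ((Perm.sign σ : ℤ) : R) *
    (((otherCycleMins σ j).map fun c => g (cycleProd A σ c)).prod * u *
      cycleProd (A.updateCol j v) σ j)

theorem mem_otherCycleMins {σ : Perm ι} {j c : ι} :
    c ∈ otherCycleMins σ j ↔ ¬ σ.SameCycle j c ∧ ∀ d, σ.SameCycle c d → c ≤ d := by
  simp [otherCycleMins]

/-- Permutations are sorted by the image of `e none`: fixed, or sent to some `b`, with a change of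
sign. In the second case the split-off entry stands just left of the remaining cycle; the parameter
`u` exists to absorb it. -/
theorem cdetAux_succ (g : R → R) (e : Option α ≃ ι) (he : StrictMono fun a => e (some a))
    (A : Matrix ι ι R) (u : R) (v : ι → R) :
    cdetAux g A (e none) u v =
      hdetAux g (A.submatrix (fun a => e (some a)) fun a => e (some a)) * u * v (e none) -
      ∑ b, cdetAux g (A.submatrix (fun a => e (some a)) fun a => e (some a)) b
        (u * A (e none) (e (some b))) fun a => v (e (some a)) := by
  rw [cdetAux, sum_perm_eq_sum_insertPerm e, sub_eq_add_neg, ← Finset.sum_neg_distrib]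
  congr 1
  · rw [hdetAux, Finset.sum_mul, Finset.sum_mul]
    refine Finset.sum_congr rfl fun σ _ => ?_
    rw [sign_insertPerm_none, otherCycleMins_insertPerm_none e he, List.map_map,
      cycleProd_updateCol_insertPerm_none]
    simp only [Function.comp_def, cycleProd_insertPerm_none, mul_assoc]
  · refine Finset.sum_congr rfl fun b _ => ?_
    rw [cdetAux, ← Finset.sum_neg_distrib]
    refine Finset.sum_congr rfl fun σ _ => ?_
    rw [sign_insertPerm_some, otherCycleMins_insertPerm_some e he, List.map_map,
      cycleProd_updateCol_insertPerm_some]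
    have : (otherCycleMins σ b).map
          ((fun c => g (cycleProd A (insertPerm e (some b) σ) c)) ∘ fun a => e (some a)) =
        (otherCycleMins σ b).map fun c =>
          g (cycleProd (A.submatrix (fun a => e (some a)) fun a => e (some a)) σ c) :=
      List.map_congr_left fun c hc => by
        rw [Function.comp_apply, cycleProd_insertPerm_some e σ A (mem_otherCycleMins.1 hc).1]
    rw [this]
    simp [mul_assoc]

theorem cdet_updateCol (A : Matrix ι ι R) (j : ι) (v : ι → R) :
    cdet j (A.updateCol j v) = cdetAux id A j 1 v := by
  refine Finset.sum_congr rfl fun σ _ => ?_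
  rw [List.map_congr_left fun c hc =>
    cycleProd_updateCol_of_not_sameCycle A v (mem_otherCycleMins.1 hc).1]
  simp

theorem cdet_eq_cdetAux (A : Matrix ι ι R) (j : ι) :
    cdet j A = cdetAux id A j 1 fun s => A s j := by
  rw [← cdet_updateCol]
  congr 1
  exact (Matrix.updateCol_eq_self A j).symm

theorem cycleMins_eq_append (σ : Perm ι) (h : (Finset.univ : Finset ι).Nonempty) :
    cycleMins σ = otherCycleMins σ (Finset.univ.min' h) ++ [Finset.univ.min' h] := by
  set j := Finset.univ.min' h with hj
  have hmin : ∀ d, j ≤ d := fun d => Finset.min'_le _ _ (Finset.mem_univ d)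
  refine List.Perm.eq_of_pairwise (le := (· ≥ ·)) (fun a b _ _ hab hba => le_antisymm hba hab)
    (Finset.pairwise_sort _ _) ?_ ?_
  · rw [List.pairwise_append]
    refine ⟨Finset.pairwise_sort _ _, List.pairwise_singleton _ _, ?_⟩
    intro a _ b hb
    rw [List.mem_singleton.1 hb]
    exact hmin a
  · refine (List.perm_ext_iff_of_nodup (Finset.sort_nodup _ _) ?_).2 ?_
    · rw [List.nodup_append]
      refine ⟨Finset.sort_nodup _ _, List.nodup_singleton _, ?_⟩
      intro a ha b hb hab
      rw [List.mem_singleton.1 hb] at hab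
      exact (mem_otherCycleMins.1 ha).1 (hab ▸ Perm.SameCycle.refl _ _)
    · intro c
      simp only [Finset.mem_sort, Finset.mem_filter, Finset.mem_univ, true_and,
        List.mem_append, mem_otherCycleMins, List.mem_singleton]
      constructor
      · intro hc
        by_cases hjc : σ.SameCycle j c
        · exact Or.inr (le_antisymm (hc j hjc.symm) (hmin c))
        · exact Or.inl ⟨hjc, hc⟩
      · rintro (hc | rfl)
        · exact hc.2
        · exact fun d _ => hmin d

theorem hdetAux_id_of_nonempty (A : Matrix ι ι R) (h : (Finset.univ : Finset ι).Nonempty) :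
    hdetAux id A = cdet (Finset.univ.min' h) A := by
  refine Finset.sum_congr rfl fun σ _ => ?_
  rw [cycleMins_eq_append σ h]
  simp

theorem hdetAux_of_isEmpty [IsEmpty ι] (g : R → R) (A : Matrix ι ι R) : hdetAux g A = 1 := by
  have : ∀ σ : Perm ι, cycleMins σ = [] := fun σ => by
    simp [cycleMins, Finset.univ_eq_empty]
  simp [hdetAux, this]

theorem hdet_eq_hdetAux (A : Matrix ι ι R) : hdet A = hdetAux id A := by
  rw [hdet]
  split_ifs with h
  · exact (hdetAux_id_of_nonempty A h).symm
  · have : IsEmpty ι := by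
      rwa [Finset.univ_nonempty_iff, not_nonempty_iff] at h
    exact (hdetAux_of_isEmpty id A).symm

end Expansion

/-! ### Real parts of cycle products; Hermitian matrices -/

section Hermitian

open Quaternion

variable {ι : Type*} [Fintype ι]

theorem re_sum {β : Type*} (s : Finset β) (f : β → ℍ[ℝ]) :
    (∑ i ∈ s, f i).re = ∑ i ∈ s, (f i).re :=
  map_sum (AddMonoidHom.mk' (fun q : ℍ[ℝ] => q.re) fun _ _ => rfl) f s

theorem re_mul_comm (a b : ℍ[ℝ]) : (a * b).re = (b * a).re := by
  simp only [Quaternion.re_mul]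
  ring

theorem re_cycleProd_apply (A : Matrix ι ι ℍ[ℝ]) (σ : Perm ι) (c : ι) :
    (cycleProd A σ (σ c)).re = (cycleProd A σ c).re := by
  have hp : Function.minimalPeriod σ (σ c) = Function.minimalPeriod σ c :=
    Function.minimalPeriod_apply (Function.minimalPeriod_pos_iff_mem_periodicPts.1
      (minimalPeriod_pos σ c))
  obtain ⟨p, hp'⟩ := Nat.exists_eq_succ_of_ne_zero (minimalPeriod_pos σ c).ne'
  have h := pow_minimalPeriod_apply σ c
  rw [hp'] at h
  have h1 : (σ ^ p) (σ c) = c := by rw [← Perm.mul_apply, ← pow_succ, h]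
  have h2 : (σ ^ (p + 1)) (σ c) = σ c := by
    rw [← Perm.mul_apply, ← pow_succ, pow_succ', Perm.mul_apply, h]
  have e1 : cycleProd A σ (σ c) =
      ((List.range p).map fun t => A ((σ ^ (t + 1)) c) ((σ ^ (t + 2)) c)).prod * A c (σ c) := by
    rw [cycleProd, hp, hp', Nat.succ_eq_add_one, List.range_succ, List.map_append, List.prod_append,
      List.map_singleton, List.prod_singleton, h1, h2]
    simp only [← Perm.mul_apply, ← pow_succ]
  have e2 : cycleProd A σ c =
      A c (σ c) * ((List.range p).map fun t => A ((σ ^ (t + 1)) c) ((σ ^ (t + 2)) c)).prod := by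
    rw [cycleProd, hp', Nat.succ_eq_add_one, List.range_succ_eq_map, List.map_cons, List.prod_cons,
      List.map_map]
    rfl
  rw [e1, e2, re_mul_comm]

theorem re_cycleProd_eq_of_sameCycle (A : Matrix ι ι ℍ[ℝ]) {σ : Perm ι} {c d : ι}
    (h : σ.SameCycle c d) : (cycleProd A σ d).re = (cycleProd A σ c).re := by
  classical
  obtain ⟨i, -, -, rfl⟩ := h.exists_pow_eq
  induction i with
  | zero => rfl
  | succ i ih =>
    rw [pow_succ', Perm.mul_apply, re_cycleProd_apply, ih (sameCycle_pow_right σ c i)]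

variable [LinearOrder ι]

/-- The real part as a map from the quaternions to themselves. -/
noncomputable def reCoe (q : ℍ[ℝ]) : ℍ[ℝ] := (q.re : ℍ[ℝ])

theorem prod_map_reCoe {β : Type*} (l : List β) (f : β → ℍ[ℝ]) :
    (l.map fun c => reCoe (f c)).prod = (((l.map fun c => (f c).re).prod : ℝ) : ℍ[ℝ]) := by
  induction l with
  | nil => simp
  | cons a l ih =>
    rw [List.map_cons, List.prod_cons, ih, List.map_cons, List.prod_cons, Quaternion.coe_mul, reCoe]

/-- The alternating sum over all permutations of the products over all cycles of the real parts of
the cycle products. -/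
noncomputable def redet (A : Matrix ι ι ℍ[ℝ]) : ℝ :=
  ∑ σ : Perm ι, ((Perm.sign σ : ℤ) : ℝ) * ((cycleMins σ).map fun c => (cycleProd A σ c).re).prod

theorem hdetAux_reCoe (A : Matrix ι ι ℍ[ℝ]) : hdetAux reCoe A = (redet A : ℍ[ℝ]) := by
  rw [hdetAux, redet, ← Quaternion.algebraMap_def, map_sum]
  refine Finset.sum_congr rfl fun σ _ => ?_
  rw [prod_map_reCoe, Quaternion.algebraMap_def, Quaternion.coe_mul, Quaternion.coe_intCast]

theorem cdetAux_reCoe (A : Matrix ι ι ℍ[ℝ]) (j : ι) (u : ℍ[ℝ]) (v : ι → ℍ[ℝ]) :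
    cdetAux reCoe A j u v = u * cdetAux reCoe A j 1 v := by
  rw [cdetAux, cdetAux, Finset.mul_sum]
  refine Finset.sum_congr rfl fun σ _ => ?_
  rw [prod_map_reCoe, mul_one, Quaternion.coe_commutes, mul_assoc, ← mul_assoc,
    (Int.cast_commute _ u).eq, mul_assoc]

theorem prod_cycleMins (σ : Perm ι) (j : ι) (f : ι → ℝ) (hf : ∀ c d, σ.SameCycle c d → f c = f d) :
    ((cycleMins σ).map f).prod = ((otherCycleMins σ j).map f).prod * f j := by
  classical
  have hsort : ∀ s : Finset ι, ((s.sort (· ≥ ·)).map f).prod = ∏ c ∈ s, f c := by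
    intro s
    rw [← Finset.prod_map_toList]
    exact ((Finset.sort_perm_toList s _).map f).prod_eq
  rw [cycleMins, otherCycleMins, hsort, hsort]
  have hne : (Finset.univ.filter fun c => σ.SameCycle j c).Nonempty :=
    ⟨j, by simp [Perm.SameCycle.refl]⟩
  set c₀ := (Finset.univ.filter fun c => σ.SameCycle j c).min' hne with hc₀
  have hjc : σ.SameCycle j c₀ := by
    have := Finset.min'_mem _ hne
    simpa using this
  have hmin : ∀ d, σ.SameCycle j d → c₀ ≤ d := fun d hd => Finset.min'_le _ _ (by simpa using hd)
  have : (Finset.univ.filter fun c => ∀ d, σ.SameCycle c d → c ≤ d) =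
      insert c₀ (Finset.univ.filter fun c => ¬ σ.SameCycle j c ∧ ∀ d, σ.SameCycle c d → c ≤ d) := by
    ext c
    simp only [Finset.mem_filter, Finset.mem_univ, true_and, Finset.mem_insert]
    constructor
    · intro hc
      by_cases h : σ.SameCycle j c
      · exact Or.inl (le_antisymm (hc _ (h.symm.trans hjc)) (hmin c h))
      · exact Or.inr ⟨h, hc⟩
    · rintro (rfl | hc)
      · exact fun d hd => hmin d (hjc.trans hd)
      · exact hc.2
  rw [this, Finset.prod_insert (by simp [hjc]), mul_comm, hf _ _ hjc]

theorem otherCycleMins_inv (σ : Perm ι) (j : ι) : otherCycleMins σ⁻¹ j = otherCycleMins σ j := by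
  simp [otherCycleMins]

/-- Pairing `σ` with `σ⁻¹` makes the sum self-conjugate, hence real. The real part of a cycle
product does not depend on its starting point, so the real part of the sum does not depend on `j`.
-/
theorem cdetAux_reCoe_self {A : Matrix ι ι ℍ[ℝ]} (hA : A.IsHermitian) (j : ι) :
    (cdetAux reCoe A j 1 fun s => A s j) = (redet A : ℍ[ℝ]) := by
  have hcol : A.updateCol j (fun s => A s j) = A := Matrix.updateCol_eq_self A j
  have hre : ∀ σ : Perm ι, ∀ c, (cycleProd A σ⁻¹ c).re = (cycleProd A σ c).re := fun σ c => by
    rw [cycleProd_inv hA, Quaternion.re_star]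
  have hS : (cdetAux reCoe A j 1 fun s => A s j) = ∑ σ : Perm ι,
      ((((Perm.sign σ : ℤ) : ℝ) * ((otherCycleMins σ j).map fun c => (cycleProd A σ c).re).prod : ℝ) :
        ℍ[ℝ]) * cycleProd A σ j := by
    refine Finset.sum_congr rfl fun σ _ => ?_
    rw [hcol, prod_map_reCoe, mul_one, Quaternion.coe_mul, Quaternion.coe_intCast, mul_assoc]
  have hstar : star (cdetAux reCoe A j 1 fun s => A s j) = cdetAux reCoe A j 1 fun s => A s j := by
    rw [hS, star_sum, ← Equiv.sum_comp (Equiv.inv (Perm ι))]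
    refine Finset.sum_congr rfl fun σ _ => ?_
    rw [Equiv.inv_apply, star_mul, cycleProd_inv hA, star_star, Quaternion.star_coe,
      Quaternion.coe_commutes, Perm.sign_inv, otherCycleMins_inv]
    simp only [hre]
  rw [Quaternion.star_eq_self] at hstar
  rw [hstar, hS, re_sum, redet]
  congr 1
  refine Finset.sum_congr rfl fun σ _ => ?_
  rw [Quaternion.coe_mul_eq_smul, Quaternion.re_smul, smul_eq_mul, mul_assoc,
    prod_cycleMins σ j _ fun c d h => (re_cycleProd_eq_of_sameCycle A h).symm]

end Hermitian

end QMat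

namespace QMat

open Equiv Quaternion

/-! ### Principal minors and their cofactors -/

section Minors

theorem principal_isHermitian {ι : Type*} {H : Matrix ι ι ℍ[ℝ]} (hH : H.IsHermitian) (γ : Finset ι) :
    (principal H γ).IsHermitian :=
  hH.submatrix _

variable {ι : Type*} [LinearOrder ι]

/-- A finite set is one of its points together with the rest. -/
def optionEraseEquiv {γ : Finset ι} {i : ι} (h : i ∈ γ) : Option ↥(γ.erase i) ≃ ↥γ where
  toFun x := x.elim ⟨i, h⟩ fun a => ⟨a.1, Finset.mem_of_mem_erase a.2⟩
  invFun x := if hx : x.1 = i then none else some ⟨x.1, Finset.mem_erase.2 ⟨hx, x.2⟩⟩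
  left_inv x := by
    rcases x with _ | a
    · simp
    · simp [Finset.ne_of_mem_erase a.2]
  right_inv x := by
    by_cases hx : x.1 = i
    · subst hx
      simp
    · simp [hx]

/-- The Hermitian determinant of a principal submatrix. -/
noncomputable def minor (H : Matrix ι ι ℍ[ℝ]) (γ : Finset ι) : ℝ :=
  redet (principal H γ)

/-- The `i`-th column determinant of the principal submatrix on `γ` with column `i` replaced by `v`. -/
noncomputable def cminor (H : Matrix ι ι ℍ[ℝ]) (γ : Finset ι) (i : ι) (v : ι → ℍ[ℝ]) : ℍ[ℝ] :=
  if h : i ∈ γ then cdetAux reCoe (principal H γ) ⟨i, h⟩ 1 fun s => v s else 0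

theorem cminor_of_notMem (H : Matrix ι ι ℍ[ℝ]) {γ : Finset ι} {i : ι} (h : i ∉ γ)
    (v : ι → ℍ[ℝ]) : cminor H γ i v = 0 :=
  dif_neg h

theorem cdetAux_principal (g : ℍ[ℝ] → ℍ[ℝ]) (H : Matrix ι ι ℍ[ℝ]) {γ : Finset ι} {i : ι}
    (h : i ∈ γ) (u : ℍ[ℝ]) (v : γ → ℍ[ℝ]) :
    cdetAux g (principal H γ) ⟨i, h⟩ u v =
      hdetAux g (principal H (γ.erase i)) * u * v ⟨i, h⟩ -
        ∑ b : ↥(γ.erase i), cdetAux g (principal H (γ.erase i)) b (u * H i b)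
          fun a => v ⟨a.1, Finset.mem_of_mem_erase a.2⟩ :=
  cdetAux_succ g (optionEraseEquiv h) (fun _ _ hab => hab) (principal H γ) u v

theorem minor_empty (H : Matrix ι ι ℍ[ℝ]) : minor H ∅ = 1 := by
  have := hdetAux_of_isEmpty reCoe (principal H ∅)
  rw [hdetAux_reCoe, ← Quaternion.coe_one] at this
  exact Quaternion.coe_injective this

theorem cminor_eq (H : Matrix ι ι ℍ[ℝ]) {γ : Finset ι} {i : ι} (h : i ∈ γ) (v : ι → ℍ[ℝ]) :
    cminor H γ i v = minor H (γ.erase i) * v i -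
      ∑ x ∈ γ.erase i, H i x * cminor H (γ.erase i) x v := by
  rw [cminor, dif_pos h, cdetAux_principal, hdetAux_reCoe, mul_one, ← Finset.sum_coe_sort (γ.erase i)]
  congr 1
  refine Finset.sum_congr rfl fun b _ => ?_
  rw [cdetAux_reCoe, one_mul, cminor, dif_pos b.2]

theorem cminor_self {H : Matrix ι ι ℍ[ℝ]} (hH : H.IsHermitian) {γ : Finset ι} {i : ι} (h : i ∈ γ) :
    (cminor H γ i fun s => H s i) = minor H γ := by
  rw [cminor, dif_pos h]
  exact cdetAux_reCoe_self (principal_isHermitian hH γ) ⟨i, h⟩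

/-- Both versions obey the same row expansion. By induction the smaller minors in it are real, so
`u` can be pulled out on the left in the genuine version too; the minor on `γ` is then the column
determinant at the least index. -/
theorem hdetAux_cdetAux_principal {H : Matrix ι ι ℍ[ℝ]} (hH : H.IsHermitian) (γ : Finset ι) :
    hdetAux id (principal H γ) = minor H γ ∧ ∀ (j : γ) (u : ℍ[ℝ]) (v : γ → ℍ[ℝ]),
      cdetAux id (principal H γ) j u v = u * cdetAux reCoe (principal H γ) j 1 v := by
  induction γ using Finset.strongInduction with
  | H γ ih =>
    have hc : ∀ (j : γ) (u : ℍ[ℝ]) (v : γ → ℍ[ℝ]),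
        cdetAux id (principal H γ) j u v = u * cdetAux reCoe (principal H γ) j 1 v := by
      rintro ⟨i, hi⟩ u v
      obtain ⟨ih₁, ih₂⟩ := ih (γ.erase i) (Finset.erase_ssubset hi)
      rw [cdetAux_principal, cdetAux_principal, mul_sub, Finset.mul_sum, hdetAux_reCoe, ih₁, minor]
      congr 1
      · rw [mul_one, Quaternion.coe_commutes, mul_assoc]
      · refine Finset.sum_congr rfl fun b _ => ?_
        rw [ih₂, cdetAux_reCoe _ _ (1 * _), one_mul, mul_assoc]
    refine ⟨?_, hc⟩
    rcases γ.eq_empty_or_nonempty with rfl | hne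
    · rw [hdetAux_of_isEmpty, minor_empty, Quaternion.coe_one]
    · have hne' : (Finset.univ : Finset γ).Nonempty := by
        simpa [Finset.univ_nonempty_iff] using hne
      rw [hdetAux_id_of_nonempty _ hne', cdet_eq_cdetAux, hc, one_mul,
        cdetAux_reCoe_self (principal_isHermitian hH γ), minor]

theorem hdet_principal {H : Matrix ι ι ℍ[ℝ]} (hH : H.IsHermitian) (γ : Finset ι) :
    hdet (principal H γ) = minor H γ := by
  rw [hdet_eq_hdetAux, (hdetAux_cdetAux_principal hH γ).1]

theorem cdet_principal_updateCol {H : Matrix ι ι ℍ[ℝ]} (hH : H.IsHermitian) {γ : Finset ι} {i : ι}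
    (h : i ∈ γ) (v : ι → ℍ[ℝ]) :
    cdet ⟨i, h⟩ (principal (H.updateCol i v) γ) = cminor H γ i v := by
  have key := cdet_updateCol (principal H γ) ⟨i, h⟩ fun s => v s
  rw [(hdetAux_cdetAux_principal hH γ).2, one_mul] at key
  rw [cminor, dif_pos h, ← key]
  congr 1
  ext1 s t
  simp [principal, Matrix.updateCol_apply, Subtype.ext_iff]

theorem cminor_eq_sum [Fintype ι] (H : Matrix ι ι ℍ[ℝ]) (γ : Finset ι) (i : ι) (v : ι → ℍ[ℝ]) :
    cminor H γ i v = ∑ s, cminor H γ i (Pi.single s 1) * v s := by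
  induction γ using Finset.strongInduction generalizing i with
  | H γ ih =>
    by_cases hi : i ∈ γ
    · simp only [cminor_eq H hi, sub_mul, Finset.sum_sub_distrib, Finset.sum_mul]
      congr 1
      · rw [Finset.sum_eq_single i]
        · simp
        · intro b _ hb
          simp [hb.symm]
        · simp
      · rw [Finset.sum_comm]
        refine Finset.sum_congr rfl fun x hx => ?_
        rw [ih _ (Finset.erase_ssubset hi), Finset.mul_sum]
        simp only [mul_assoc]
    · simp [cminor_of_notMem H hi]

theorem cminor_eq_zero (H : Matrix ι ι ℍ[ℝ]) (γ : Finset ι) (i : ι) {v : ι → ℍ[ℝ]}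
    (hv : ∀ s ∈ γ, v s = 0) : cminor H γ i v = 0 := by
  induction γ using Finset.strongInduction generalizing i with
  | H γ ih =>
    by_cases hi : i ∈ γ
    · rw [cminor_eq H hi, hv i hi, mul_zero, zero_sub, neg_eq_zero]
      refine Finset.sum_eq_zero fun x _ => ?_
      rw [ih _ (Finset.erase_ssubset hi) x fun s hs => hv s (Finset.mem_of_mem_erase hs), mul_zero]
    · exact cminor_of_notMem H hi v

theorem cminor_single_self (H : Matrix ι ι ℍ[ℝ]) {γ : Finset ι} {i : ι} (h : i ∈ γ) :
    cminor H γ i (Pi.single i 1) = minor H (γ.erase i) := by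
  rw [cminor_eq H h, Finset.sum_eq_zero, Pi.single_eq_same, mul_one, sub_zero]
  intro x _
  rw [cminor_eq_zero, mul_zero]
  intro s hs
  exact Pi.single_eq_of_ne (Finset.ne_of_mem_erase hs) 1

/-- In the row expansion only `x = j` survives the induction; it cancels the leading term because
the minor is real and commutes with `H i j`. -/
theorem cminor_col_eq_zero {H : Matrix ι ι ℍ[ℝ]} (hH : H.IsHermitian) {γ : Finset ι} {i j : ι}
    (hij : i ≠ j) (hj : j ∈ γ) : (cminor H γ i fun s => H s j) = 0 := by
  induction γ using Finset.strongInduction generalizing i with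
  | H γ ih =>
    by_cases hi : i ∈ γ
    · have hj' : j ∈ γ.erase i := Finset.mem_erase.2 ⟨hij.symm, hj⟩
      rw [cminor_eq H hi, Finset.sum_eq_single j, cminor_self hH hj', Quaternion.coe_commutes,
        sub_self]
      · intro x _ hxj
        rw [ih _ (Finset.erase_ssubset hi) hxj hj', mul_zero]
      · exact fun h => absurd hj' h
    · exact cminor_of_notMem H hi _

/-- Expanding both sides along row `i`, the term `x = j` on the left matches the leading term on the
right; the others match by induction. -/
theorem cminor_insert_single (H : Matrix ι ι ℍ[ℝ]) {γ : Finset ι} {i j : ι} (hi : i ∈ γ)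
    (hj : j ∉ γ) :
    cminor H (insert j γ) i (Pi.single j 1) = -cminor H γ i fun s => H s j := by
  induction γ using Finset.strongInduction generalizing i with
  | H γ ih =>
    have hij : i ≠ j := fun h => hj (h ▸ hi)
    have hj' : j ∉ γ.erase i := fun h => hj (Finset.mem_of_mem_erase h)
    rw [cminor_eq H (Finset.mem_insert_of_mem hi), cminor_eq H hi,
      Finset.erase_insert_of_ne hij.symm, Finset.sum_insert hj',
      cminor_single_self H (Finset.mem_insert_self _ _), Finset.erase_insert hj',
      Pi.single_eq_of_ne hij, mul_zero, zero_sub, neg_sub, neg_add, Quaternion.coe_commutes,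
      sub_eq_add_neg, add_comm, ← Finset.sum_neg_distrib]
    congr 1
    refine Finset.sum_congr rfl fun x hx => ?_
    rw [ih _ (Finset.erase_ssubset hi) hx hj', mul_neg, neg_neg]

end Minors

/-! ### Faddeev–LeVerrier recursion -/

section Adjugates

theorem eq_zero_of_mul_conjTranspose {κ ι : Type*} [Fintype ι]
    (Z : Matrix κ ι ℍ[ℝ])
    (h : Z * Z.conjTranspose = 0) : Z = 0 := by
  ext1 a b
  have h1 := congrArg (fun q : ℍ[ℝ] => q.re) (congrFun (congrFun h a) a)
  simp only [Matrix.mul_apply, re_sum, Matrix.zero_apply, Quaternion.re_zero] at h1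
  have h2 : ∀ s, (Z a s * Z.conjTranspose s a).re = normSq (Z a s) := fun s => by
    rw [Matrix.conjTranspose_apply, Quaternion.normSq_def]
  rw [Finset.sum_congr rfl fun s _ => h2 s,
    Finset.sum_eq_zero_iff_of_nonneg fun s _ => Quaternion.normSq_nonneg] at h1
  exact Quaternion.normSq_eq_zero.1 (h1 b (Finset.mem_univ b))

variable {ι : Type*} [LinearOrder ι] [Fintype ι]

/-- The sum of the principal minors of order `q`. -/
noncomputable def minorSum (H : Matrix ι ι ℍ[ℝ]) (q : ℕ) : ℝ :=
  ∑ γ ∈ Finset.univ.powersetCard q, minor H γ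

/-- The sum of the left adjugates of the principal submatrices of order `q`. -/
noncomputable def adjSum (H : Matrix ι ι ℍ[ℝ]) (q : ℕ) : Matrix ι ι ℍ[ℝ] :=
  Matrix.of fun i s => ∑ γ ∈ Finset.univ.powersetCard q, cminor H γ i (Pi.single s 1)

theorem adjSum_mulVec (H : Matrix ι ι ℍ[ℝ]) (q : ℕ) (v : ι → ℍ[ℝ]) (i : ι) :
    (adjSum H q).mulVec v i = ∑ γ ∈ Finset.univ.powersetCard q, cminor H γ i v := by
  simp only [Matrix.mulVec, dotProduct, adjSum, Matrix.of_apply, Finset.sum_mul]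
  rw [Finset.sum_comm]
  exact Finset.sum_congr rfl fun γ _ => (cminor_eq_sum H γ i v).symm

theorem adjSum_mul_apply {κ : Type*} (H : Matrix ι ι ℍ[ℝ]) (B : Matrix ι κ ℍ[ℝ]) (q : ℕ) (i : ι)
    (j : κ) :
    (adjSum H q * B) i j =
      ∑ γ ∈ Finset.univ.powersetCard q, cminor H γ i fun s => B s j :=
  adjSum_mulVec H q (fun s => B s j) i

theorem adjSum_zero (H : Matrix ι ι ℍ[ℝ]) : adjSum H 0 = 0 := by
  ext1 i s
  simp [adjSum, cminor_of_notMem]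

theorem minorSum_zero (H : Matrix ι ι ℍ[ℝ]) : minorSum H 0 = 1 := by
  simp [minorSum, minor_empty]

theorem sum_powersetCard_succ_mem {M : Type*} [AddCommMonoid M] (q : ℕ) (j : ι)
    (f : Finset ι → M) :
    ∑ γ ∈ Finset.univ.powersetCard (q + 1) with j ∈ γ, f γ =
      ∑ γ ∈ Finset.univ.powersetCard q with j ∉ γ, f (insert j γ) := by
  symm
  refine Finset.sum_bij' (fun γ _ => insert j γ) (fun γ _ => γ.erase j) ?_ ?_ ?_ ?_ ?_
  · intro γ h
    simp only [Finset.mem_filter, Finset.mem_powersetCard_univ] at h ⊢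
    exact ⟨by rw [Finset.card_insert_of_notMem h.2, h.1], Finset.mem_insert_self _ _⟩
  · intro γ h
    simp only [Finset.mem_filter, Finset.mem_powersetCard_univ] at h ⊢
    exact ⟨by rw [Finset.card_erase_of_mem h.2, h.1]; rfl, Finset.notMem_erase _ _⟩
  · intro γ h
    exact Finset.erase_insert (Finset.mem_filter.1 h).2
  · intro γ h
    exact Finset.insert_erase (Finset.mem_filter.1 h).2
  · intros; rfl

/-- Only sets `insert j γ` contribute to column `j` of `adjSum H (q + 1)`. On the diagonal, sets
avoiding `i` and sets containing `i` together supply all minors of order `q`; off the diagonal the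
terms cancel by `cminor_insert_single`. -/
theorem adjSum_succ {H : Matrix ι ι ℍ[ℝ]} (hH : H.IsHermitian) (q : ℕ) :
    adjSum H (q + 1) = minorSum H q • (1 : Matrix ι ι ℍ[ℝ]) - adjSum H q * H := by
  rw [eq_sub_iff_add_eq]
  ext1 i j
  rw [Matrix.add_apply, adjSum_mul_apply, adjSum, Matrix.of_apply]
  have h1 : ∑ γ ∈ Finset.univ.powersetCard (q + 1), cminor H γ i (Pi.single j 1) =
      ∑ γ ∈ Finset.univ.powersetCard q with j ∉ γ, cminor H (insert j γ) i (Pi.single j 1) := by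
    rw [← sum_powersetCard_succ_mem q j fun γ => cminor H γ i (Pi.single j 1),
      ← Finset.sum_filter_add_sum_filter_not (Finset.univ.powersetCard (q + 1)) fun γ => j ∈ γ]
    refine add_eq_left.2 (Finset.sum_eq_zero fun γ hγ => ?_)
    refine cminor_eq_zero H γ i fun s hs => Pi.single_eq_of_ne ?_ _
    rintro rfl
    exact (Finset.mem_filter.1 hγ).2 hs
  rw [h1, ← Finset.sum_filter_add_sum_filter_not (Finset.univ.powersetCard q) (fun γ => j ∈ γ)
    fun γ => cminor H γ i fun s => H s j]
  by_cases hij : i = j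
  · subst hij
    have h2 : ∑ γ ∈ Finset.univ.powersetCard q with i ∉ γ, (cminor H γ i fun s => H s i) = 0 :=
      Finset.sum_eq_zero fun γ hγ => cminor_of_notMem H (Finset.mem_filter.1 hγ).2 _
    rw [h2, add_zero, Matrix.smul_apply, Matrix.one_apply_eq, minorSum, add_comm,
      ← Finset.sum_filter_add_sum_filter_not (Finset.univ.powersetCard q) (fun γ => i ∈ γ), add_smul,
      Finset.sum_smul, Finset.sum_smul]
    congr 1
    · refine Finset.sum_congr rfl fun γ hγ => ?_
      rw [cminor_self hH (Finset.mem_filter.1 hγ).2, ← Quaternion.coe_mul_eq_smul, mul_one]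
    · refine Finset.sum_congr rfl fun γ hγ => ?_
      rw [cminor_single_self H (Finset.mem_insert_self _ _),
        Finset.erase_insert (Finset.mem_filter.1 hγ).2, ← Quaternion.coe_mul_eq_smul, mul_one]
  · rw [Matrix.smul_apply, Matrix.one_apply_ne hij, smul_zero]
    have h2 : ∑ γ ∈ Finset.univ.powersetCard q with j ∈ γ, (cminor H γ i fun s => H s j) = 0 :=
      Finset.sum_eq_zero fun γ hγ => cminor_col_eq_zero hH hij (Finset.mem_filter.1 hγ).2
    rw [h2, zero_add, ← Finset.sum_add_distrib]
    refine Finset.sum_eq_zero fun γ hγ => ?_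
    have hj := (Finset.mem_filter.1 hγ).2
    by_cases hi : i ∈ γ
    · rw [cminor_insert_single H hi hj, neg_add_cancel]
    · rw [cminor_of_notMem H hi, cminor_of_notMem, add_zero]
      simp [hij, hi]

/-- Each set contributes its minor once for each of its `q` elements. -/
theorem re_trace_adjSum_mul {H : Matrix ι ι ℍ[ℝ]} (hH : H.IsHermitian) (q : ℕ) :
    (adjSum H q * H).trace.re = q * minorSum H q := by
  have : ∀ γ ∈ Finset.univ.powersetCard q, ∑ i : ι, (cminor H γ i fun s => H s i).re =
      q * minor H γ := by
    intro γ hγ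
    rw [← Finset.sum_subset (Finset.subset_univ γ) fun i _ hi => by
      rw [cminor_of_notMem H hi, Quaternion.re_zero]]
    rw [Finset.sum_congr rfl fun i hi => by rw [cminor_self hH hi, Quaternion.re_coe],
      Finset.sum_const, nsmul_eq_mul, (Finset.mem_powersetCard_univ.1 hγ)]
  rw [Matrix.trace, re_sum, minorSum, Finset.mul_sum, ← Finset.sum_congr rfl this, Finset.sum_comm]
  refine Finset.sum_congr rfl fun i _ => ?_
  rw [Matrix.diag_apply, adjSum_mul_apply, re_sum]

theorem minorSum_of_card_lt (H : Matrix ι ι ℍ[ℝ]) {q : ℕ} (hq : Fintype.card ι < q) :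
    minorSum H q = 0 := by
  rw [minorSum, Finset.powersetCard_eq_empty.2 (by simpa using hq), Finset.sum_empty]

theorem adjSum_of_card_lt (H : Matrix ι ι ℍ[ℝ]) {q : ℕ} (hq : Fintype.card ι < q) :
    adjSum H q = 0 := by
  ext1 i j
  rw [adjSum, Matrix.of_apply, Finset.powersetCard_eq_empty.2 (by simpa using hq),
    Finset.sum_empty, Matrix.zero_apply]

theorem commute_adjSum {H : Matrix ι ι ℍ[ℝ]} (hH : H.IsHermitian) (q : ℕ) :
    Commute (adjSum H q) H := by
  induction q with
  | zero => rw [adjSum_zero]; exact Commute.zero_left _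
  | succ q ih =>
    rw [adjSum_succ hH]
    exact ((Commute.one_left H).smul_left _).sub_left (ih.mul_left (Commute.refl H))

/-- If `Z H ^ (N + 2) = 0`, then `Z H ^ (N + 1)` times its conjugate transpose is `Z H ^ (2 N + 2)
Zᴴ = 0`, so the exponent drops by one. -/
theorem mul_eq_zero_of_mul_pow_eq_zero {H : Matrix ι ι ℍ[ℝ]} (hH : H.IsHermitian)
    (Z : Matrix ι ι ℍ[ℝ]) {N : ℕ} (h : Z * H ^ (N + 1) = 0) : Z * H = 0 := by
  induction N with
  | zero => simpa using h
  | succ N ih =>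
    apply ih
    apply eq_zero_of_mul_conjTranspose
    have hp : (H ^ (N + 1)).conjTranspose = H ^ (N + 1) := hH.pow (N + 1)
    rw [Matrix.conjTranspose_mul, hp, ← mul_assoc, mul_assoc Z, ← pow_add,
      show N + 1 + (N + 1) = N + 1 + 1 + N by omega, pow_add, ← mul_assoc Z, h, zero_mul, zero_mul]

theorem exists_minorSum_ne_zero {H : Matrix ι ι ℍ[ℝ]} (hH : H.IsHermitian) :
    ∃ s, minorSum H s ≠ 0 ∧ adjSum H s * H * H = minorSum H s • H := by
  classical
  set s := Nat.findGreatest (fun q => minorSum H q ≠ 0) (Fintype.card ι) with hs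
  have hs0 : minorSum H s ≠ 0 :=
    Nat.findGreatest_spec (P := fun q => minorSum H q ≠ 0) (Nat.zero_le _)
      (by rw [minorSum_zero]; exact one_ne_zero)
  have hlt : ∀ q, s < q → minorSum H q = 0 := by
    intro q hq
    by_cases hc : q ≤ Fintype.card ι
    · by_contra hne
      exact Nat.findGreatest_is_greatest hq hc hne
    · exact minorSum_of_card_lt H (by omega)
  -- Above `s` the recursion loses its scalar term; beyond the size of the matrix `adjSum` vanishes.
  have hpow : ∀ t, adjSum H (s + 1 + t) = (-1 : ℝ) ^ t • (adjSum H (s + 1) * H ^ t) := by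
    intro t
    induction t with
    | zero => simp
    | succ t ih =>
      rw [← add_assoc, adjSum_succ hH, hlt _ (by omega), zero_smul, zero_sub, ih, pow_succ,
        pow_succ, Matrix.smul_mul, mul_assoc, mul_neg_one, neg_smul]
  refine ⟨s, hs0, ?_⟩
  have h0 := hpow (Fintype.card ι + 1)
  rw [adjSum_of_card_lt H (by omega), eq_comm, smul_eq_zero] at h0
  have h1 := mul_eq_zero_of_mul_pow_eq_zero hH _ (h0.resolve_left (by simp))
  rw [adjSum_succ hH, sub_mul, Matrix.smul_mul, one_mul, sub_eq_zero] at h1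
  exact h1.symm

end Adjugates

end QMat

namespace QMat

open Quaternion

/-! ### Rank and trace of idempotents -/

section Rank

/-- The right column space of a quaternion matrix. -/
noncomputable def colSpace {m n : ℕ} (A : Matrix (Fin m) (Fin n) ℍ[ℝ]) :
    Submodule ℍ[ℝ]ᵐᵒᵖ (Fin m → ℍ[ℝ]) :=
  Submodule.span ℍ[ℝ]ᵐᵒᵖ (Set.range fun j : Fin n => fun i : Fin m => A i j)

theorem rank_eq_finrank_colSpace {m n : ℕ} (A : Matrix (Fin m) (Fin n) ℍ[ℝ]) :
    rank A = Module.finrank ℍ[ℝ]ᵐᵒᵖ (colSpace A) := rfl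

theorem colSpace_mul_le {m n p : ℕ} (A : Matrix (Fin m) (Fin n) ℍ[ℝ])
    (B : Matrix (Fin n) (Fin p) ℍ[ℝ]) : colSpace (A * B) ≤ colSpace A := by
  refine Submodule.span_le.2 ?_
  rintro _ ⟨j, rfl⟩
  have : (fun i => (A * B) i j) = ∑ s, MulOpposite.op (B s j) • fun i => A i s := by
    ext1 i
    rw [Finset.sum_apply]
    rfl
  refine Set.mem_of_eq_of_mem this ?_
  exact Submodule.sum_mem _ fun s _ => Submodule.smul_mem _ _ (Submodule.subset_span ⟨s, rfl⟩)

theorem rank_eq_of_mul_eq {m n p : ℕ} {A : Matrix (Fin m) (Fin n) ℍ[ℝ]}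
    {B : Matrix (Fin m) (Fin p) ℍ[ℝ]} (C : Matrix (Fin n) (Fin p) ℍ[ℝ])
    (D : Matrix (Fin p) (Fin n) ℍ[ℝ]) (h₁ : A * C = B) (h₂ : B * D = A) : rank A = rank B := by
  have : colSpace A = colSpace B :=
    le_antisymm (h₂ ▸ colSpace_mul_le B D) (h₁ ▸ colSpace_mul_le A C)
  rw [rank_eq_finrank_colSpace, rank_eq_finrank_colSpace, this]

theorem re_trace_mul_comm {ι κ : Type*} [Fintype ι] [Fintype κ] (B : Matrix ι κ ℍ[ℝ])
    (C : Matrix κ ι ℍ[ℝ]) : (B * C).trace.re = (C * B).trace.re := by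
  simp only [Matrix.trace, Matrix.diag_apply, Matrix.mul_apply, re_sum]
  rw [Finset.sum_comm]
  simp only [re_mul_comm (B _ _)]

/-- Factor `E = B C` with the columns of `B` a basis of the column space. From `E B = B` follows `B
(C B - 1) = 0`, hence `C B = 1`; the real part of the trace is cyclic. -/
theorem re_trace_of_idempotent {m : ℕ} {E : Matrix (Fin m) (Fin m) ℍ[ℝ]} (hE : E * E = E) :
    E.trace.re = rank E := by
  have hfin : Module.Finite ℍ[ℝ]ᵐᵒᵖ (colSpace E) :=
    FiniteDimensional.span_of_finite _ (Set.finite_range _)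
  let b := Module.finBasis ℍ[ℝ]ᵐᵒᵖ (colSpace E)
  have hcol : ∀ j, (fun i => E i j) ∈ colSpace E := fun j => Submodule.subset_span ⟨j, rfl⟩
  let B : Matrix (Fin m) (Fin (Module.finrank ℍ[ℝ]ᵐᵒᵖ (colSpace E))) ℍ[ℝ] :=
    Matrix.of fun i a => (b a).1 i
  let C : Matrix (Fin (Module.finrank ℍ[ℝ]ᵐᵒᵖ (colSpace E))) (Fin m) ℍ[ℝ] :=
    Matrix.of fun a j => (b.repr ⟨_, hcol j⟩ a).unop
  have hBC : B * C = E := by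
    ext1 i j
    have h := congrArg (fun w : colSpace E => w.1 i) (b.sum_repr ⟨_, hcol j⟩)
    simp only [Submodule.coe_sum, Finset.sum_apply] at h
    exact h
  have hfix : ∀ v ∈ colSpace E, E.mulVec v = v := by
    intro v hv
    induction hv using Submodule.span_induction with
    | mem v hv =>
      obtain ⟨j, rfl⟩ := hv
      ext1 i
      exact congrFun (congrFun hE i) j
    | zero => exact Matrix.mulVec_zero E
    | add v w _ _ hv hw => rw [Matrix.mulVec_add, hv, hw]
    | smul q v _ hv => rw [Matrix.mulVec_smul, hv]
  have hEB : E * B = B := by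
    ext1 i a
    exact congrFun (hfix _ (b a).2) i
  have hCB : C * B = 1 := by
    obtain ⟨Z, hZ⟩ : ∃ Z, Z = C * B - 1 := ⟨_, rfl⟩
    have h0 : B * Z = 0 := by
      rw [hZ, Matrix.mul_sub, ← Matrix.mul_assoc, hBC, hEB, Matrix.mul_one, sub_self]
    have hli := Fintype.linearIndependent_iff.1 b.linearIndependent
    ext1 a c
    have := hli (fun a => MulOpposite.op (Z a c)) (by
      ext1
      ext1 i
      simp only [Submodule.coe_sum, Finset.sum_apply]
      exact congrFun (congrFun h0 i) c) a
    refine sub_eq_zero.1 (Eq.trans ?_ (MulOpposite.op_injective this))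
    rw [hZ]
    rfl
  rw [← hBC, re_trace_mul_comm, hCB, hBC, rank_eq_finrank_colSpace]
  simp

theorem eq_zero_of_rank_eq_zero {m n : ℕ} {A : Matrix (Fin m) (Fin n) ℍ[ℝ]} (h : rank A = 0) :
    A = 0 := by
  have hfin : Module.Finite ℍ[ℝ]ᵐᵒᵖ (colSpace A) :=
    FiniteDimensional.span_of_finite _ (Set.finite_range _)
  rw [rank_eq_finrank_colSpace] at h
  have := Submodule.finrank_eq_zero.1 h
  ext1 i j
  have hc : (fun i => A i j) ∈ colSpace A := Submodule.subset_span ⟨j, rfl⟩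
  rw [this, Submodule.mem_bot] at hc
  exact congrFun hc i

end Rank

/-! ### Group inverse of a Hermitian matrix -/

section GroupInverse

variable {ι : Type*} [LinearOrder ι] [Fintype ι]

theorem exists_groupInverse {H : Matrix ι ι ℍ[ℝ]} (hH : H.IsHermitian) :
    ∃ G : Matrix ι ι ℍ[ℝ], Commute H G ∧ H * G * H = H ∧ G * H * G = G := by
  obtain ⟨s, hs, h⟩ := exists_minorSum_ne_zero hH
  obtain ⟨K, hK⟩ : ∃ K, K = (minorSum H s)⁻¹ • adjSum H s := ⟨_, rfl⟩
  have hcomm : K * H = H * K := by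
    rw [hK]
    exact ((commute_adjSum hH s).smul_left _).eq
  have hKHH : K * H * H = H := by
    rw [hK, Matrix.smul_mul, Matrix.smul_mul, h, smul_smul, inv_mul_cancel₀ hs, one_smul]
  have h1 : K * H * (K * H) = K * H := by
    rw [mul_assoc, ← mul_assoc H, ← hcomm, hKHH]
  have h2 : H * (K * H * K) = K * H := by
    rw [mul_assoc, ← hcomm, ← mul_assoc, ← hcomm, h1]
  have h3 : K * H * K * H = K * H := by rw [mul_assoc, h1]
  -- `K` commutes with `H` and is an inner inverse of it; passing to `K H K` also secures the outer
  -- equation.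
  refine ⟨K * H * K, ?_, ?_, ?_⟩
  · rw [Commute, SemiconjBy, h2, h3]
  · rw [h2, hKHH]
  · rw [h3, ← mul_assoc, ← mul_assoc, mul_assoc (K * H), h1]

end GroupInverse

end QMat

namespace QMat

open Quaternion

/-! ### Group inverses in a ring -/

section Ring

variable {R : Type*} [Ring R] {h g : R}

theorem isIdempotentElem_mul (h₁ : h * g * h = h) : IsIdempotentElem (h * g) := by
  rw [IsIdempotentElem, ← mul_assoc, h₁]

theorem pow_mul_pow_groupInverse (hc : Commute h g) (h₁ : h * g * h = h) (q : ℕ) :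
    h ^ (q + 1) * g ^ (q + 1) = h * g := by
  rw [← hc.mul_pow, (isIdempotentElem_mul h₁).pow_succ_eq]

/-- `y = h g y = g ^ (k + 1) h ^ (k + 1) y = g ^ (k + 1) h ^ k = g`. -/
theorem eq_groupInverse {y : R} {k : ℕ} (hc : Commute h g) (h₁ : h * g * h = h)
    (h₂ : g * h * g = g) (hy : Commute h y) (h₃ : y * h * y = y) (h₄ : h ^ (k + 1) * y = h ^ k) :
    y = g := by
  have e₁ : h * g * y = y := by
    have : y = h * (y * y) := by rw [← mul_assoc, hy.eq, h₃]
    rw [this, ← mul_assoc, h₁]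
  have e₂ : g ^ (k + 1) * h ^ k = g := by
    induction k with
    | zero => simp
    | succ k _ =>
      rw [pow_succ' g, mul_assoc, ← (hc.pow_pow _ _).eq, pow_mul_pow_groupInverse hc h₁,
        ← mul_assoc, h₂]
  rw [← e₁, ← pow_mul_pow_groupInverse hc h₁ k, (hc.pow_pow _ _).eq, mul_assoc, h₄, e₂]

end Ring

/-! ### The weighted Drazin inverse and its determinantal form -/

section WeightedDrazin

variable {m n : ℕ}

theorem rank_pow_succ_eq {H G : Matrix (Fin m) (Fin m) ℍ[ℝ]} (hc : Commute H G)
    (h₁ : H * G * H = H) (q : ℕ) : rank (H ^ (q + 1)) = rank (H * G) :=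
  rank_eq_of_mul_eq (G ^ (q + 1)) (H ^ (q + 1)) (pow_mul_pow_groupInverse hc h₁ q)
    (by rw [pow_succ', ← mul_assoc, h₁])

theorem pow_mul_eq_of_rank_eq {H G : Matrix (Fin m) (Fin m) ℍ[ℝ]} (hc : Commute H G)
    (h₁ : H * G * H = H) {k : ℕ} (hk : rank (H ^ (k + 1)) = rank (H ^ k)) :
    H ^ k * (H * G) = H ^ k := by
  cases k with
  | succ k => rw [pow_succ, mul_assoc, hc.eq, ← mul_assoc H, h₁]
  | zero =>
    have hE := isIdempotentElem_mul h₁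
    -- For exponent `0` the hypothesis reads `rank H = rank 1`, so the idempotent `1 - H G` has real
    -- trace, hence rank, zero.
    have hr : rank (1 - H * G) = 0 := by
      have e₁ := re_trace_of_idempotent hE.one_sub.eq
      rw [Matrix.trace_sub, Quaternion.re_sub, re_trace_of_idempotent hE.eq,
        ← rank_pow_succ_eq hc h₁ 0, hk, pow_zero, re_trace_of_idempotent (one_mul 1),
        sub_self] at e₁
      exact_mod_cast e₁.symm
    rw [pow_zero, one_mul]
    exact (sub_eq_zero.1 (eq_zero_of_rank_eq_zero hr)).symm

theorem isWeightedDrazin_iff {A : Matrix (Fin m) (Fin n) ℍ[ℝ]} {W : Matrix (Fin n) (Fin m) ℍ[ℝ]}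
    {G : Matrix (Fin m) (Fin m) ℍ[ℝ]} (hc : Commute (A * W) G) (h₁ : A * W * G * (A * W) = A * W)
    (h₂ : G * (A * W) * G = G) {k : ℕ} (hk : k = max (index (A * W)) (index (W * A)))
    (hr : rank ((A * W) ^ (k + 1)) = rank ((A * W) ^ k)) (X : Matrix (Fin m) (Fin n) ℍ[ℝ]) :
    IsWeightedDrazin A W X ↔ X = G * G * A := by
  have hHG : A * W * (G * G) = G := by rw [← mul_assoc, hc.eq, h₂]
  have hGH : G * G * (A * W) = G := by rw [mul_assoc, ← hc.eq, ← mul_assoc, h₂]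
  constructor
  · rintro ⟨e₁, e₂, e₃⟩
    rw [← hk] at e₁
    have hY : X * W = G := by
      refine eq_groupInverse (k := k) hc h₁ h₂ ?_ ?_ ?_
      · rw [Commute, SemiconjBy, ← Matrix.mul_assoc, e₃]
        simp only [Matrix.mul_assoc]
      · calc X * W * (A * W) * (X * W) = X * W * A * W * X * W := by simp only [Matrix.mul_assoc]
          _ = X * W := by rw [e₂]
      · rw [← Matrix.mul_assoc, e₁]
    calc X = X * W * (A * W * X) := by
          conv_lhs => rw [← e₂]
          simp only [Matrix.mul_assoc]
      _ = X * W * (X * W) * A := by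
          rw [e₃]
          simp only [Matrix.mul_assoc]
      _ = G * G * A := by rw [hY]
  · rintro rfl
    refine ⟨?_, ?_, ?_⟩
    · rw [← hk]
      calc (A * W) ^ (k + 1) * (G * G * A) * W = (A * W) ^ (k + 1) * (G * G * (A * W)) := by
            simp only [Matrix.mul_assoc]
        _ = (A * W) ^ k * (A * W * G) := by rw [hGH, pow_succ, mul_assoc]
        _ = (A * W) ^ k := pow_mul_eq_of_rank_eq hc h₁ hr
    · calc G * G * A * W * A * W * (G * G * A)
          = G * G * (A * W) * (A * W * (G * G)) * A := by simp only [Matrix.mul_assoc]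
        _ = G * G * A := by rw [hGH, hHG]
    · calc A * W * (G * G * A) = A * W * (G * G) * A := by simp only [Matrix.mul_assoc]
        _ = G * G * (A * W) * A := by rw [hHG, hGH]
        _ = G * G * A * W * A := by simp only [Matrix.mul_assoc]

/-- Multiplying the relation of `exists_minorSum_ne_zero` by `G ^ (q + 1)` turns a factor `H ^ (q +
1)` into `H G`; taking real traces then identifies the unknown order `s` as the rank. -/
theorem minorSum_pow_ne_zero_and_adjSum_pow_mul {H G : Matrix (Fin m) (Fin m) ℍ[ℝ]}
    (hH : H.IsHermitian) (hc : Commute H G) (h₁ : H * G * H = H) (q : ℕ) :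
    minorSum (H ^ (q + 1)) (rank (H * G)) ≠ 0 ∧
      adjSum (H ^ (q + 1)) (rank (H * G)) * H ^ (q + 1) =
        minorSum (H ^ (q + 1)) (rank (H * G)) • (H * G) := by
  obtain ⟨s, hs, h⟩ := exists_minorSum_ne_zero (hH.pow (q + 1))
  have hE : H ^ (q + 1) * (H * G) = H ^ (q + 1) := by
    rw [pow_succ, mul_assoc, hc.eq, ← mul_assoc H, h₁]
  have hP : adjSum (H ^ (q + 1)) s * H ^ (q + 1) = minorSum (H ^ (q + 1)) s • (H * G) := by
    rw [← pow_mul_pow_groupInverse hc h₁ q, ← Matrix.smul_mul, ← h, mul_assoc _ _ (G ^ (q + 1)),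
      pow_mul_pow_groupInverse hc h₁, mul_assoc, hE]
  have htr := re_trace_adjSum_mul (hH.pow (q + 1)) s
  rw [hP, Matrix.trace_smul, Quaternion.re_smul, smul_eq_mul,
    re_trace_of_idempotent (isIdempotentElem_mul h₁).eq, mul_comm] at htr
  have : rank (H * G) = s := by exact_mod_cast mul_right_cancel₀ hs htr
  rw [this]
  exact ⟨hs, hP⟩

theorem sum_hdet_principal {ι : Type*} [LinearOrder ι] [Fintype ι] {M : Matrix ι ι ℍ[ℝ]}
    (hM : M.IsHermitian) (r : ℕ) :
    ∑ β : {β : Finset ι // β.card = r}, hdet (principal M β.1) = (minorSum M r : ℍ[ℝ]) := by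
  rw [minorSum, ← Quaternion.algebraMap_def, map_sum,
    Finset.sum_subtype _ (fun β => Finset.mem_powersetCard_univ)]
  exact Finset.sum_congr rfl fun β _ => hdet_principal hM β.1

theorem sum_cdet_principal {ι : Type*} [LinearOrder ι] [Fintype ι] {M : Matrix ι ι ℍ[ℝ]}
    (hM : M.IsHermitian) (r : ℕ) (i : ι) (v : ι → ℍ[ℝ]) :
    ∑ β : {β : Finset ι // β.card = r ∧ i ∈ β},
      cdet ⟨i, β.2.2⟩ (principal (M.updateCol i v) β.1) = (adjSum M r).mulVec v i := by
  have hmem : ∀ β : Finset ι, β ∈ (Finset.univ.powersetCard r).filter (fun β => i ∈ β) ↔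
      β.card = r ∧ i ∈ β := fun β => by
    rw [Finset.mem_filter, Finset.mem_powersetCard_univ]
  rw [adjSum_mulVec, Finset.sum_congr rfl fun β _ => cdet_principal_updateCol hM β.2.2 v,
    ← Finset.sum_subtype _ hmem fun β => cminor M β i v]
  refine Finset.sum_filter_of_ne fun β _ hβ => ?_
  by_contra hi
  exact hβ (cminor_of_notMem M hi v)

end WeightedDrazin

end QMat

theorem theorem3p6 {m n : ℕ} (A : Matrix (Fin m) (Fin n) (Quaternion ℝ))
    (W : Matrix (Fin n) (Fin m) (Quaternion ℝ)) (hAW : (A * W).IsHermitian) (k r : ℕ)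
    (hk : k = max (QMat.index (A * W)) (QMat.index (W * A)))
    (hr₁ : QMat.rank ((A * W) ^ (k + 1)) = r) (hr : QMat.rank ((A * W) ^ k) = r) :
    (∃! X, QMat.IsWeightedDrazin A W X) ∧
    (∑ β : {β : Finset (Fin m) // β.card = r},
      QMat.hdet (QMat.principal ((A * W) ^ (k + 2)) β.1)) ≠ 0 ∧
    ∀ X, QMat.IsWeightedDrazin A W X → ∀ (i : Fin m) (j : Fin n),
      X i j =
        (∑ β : {β : Finset (Fin m) // β.card = r ∧ i ∈ β},
          QMat.cdet ⟨i, β.2.2⟩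
            (QMat.principal
              (((A * W) ^ (k + 2)).updateCol i fun s => ((A * W) ^ k * A) s j) β.1)) /
        (∑ β : {β : Finset (Fin m) // β.card = r},
          QMat.hdet (QMat.principal ((A * W) ^ (k + 2)) β.1)) := by
  obtain ⟨G, hc, h₁, h₂⟩ := QMat.exists_groupInverse hAW
  have hrank : QMat.rank (A * W * G) = r := by rw [← QMat.rank_pow_succ_eq hc h₁ k, hr₁]
  have hiff := QMat.isWeightedDrazin_iff hc h₁ h₂ hk (hr₁.trans hr.symm)
  have hE := QMat.pow_mul_eq_of_rank_eq hc h₁ (hr₁.trans hr.symm)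
  have hM : ((A * W) ^ (k + 2)).IsHermitian := hAW.pow (k + 2)
  obtain ⟨hd, hP⟩ := QMat.minorSum_pow_ne_zero_and_adjSum_pow_mul hAW hc h₁ (k + 1)
  rw [hrank] at hd hP
  have hd' : ((QMat.minorSum ((A * W) ^ (k + 2)) r : ℝ) : Quaternion ℝ) ≠ 0 := by
    rw [← Quaternion.coe_zero]
    exact fun h => hd (Quaternion.coe_injective h)
  -- The two extra factors in the exponent `k + 2` absorb `G G`; for `k = 0` the rank hypothesis is
  -- what makes `A W G` act as the identity.
  have hpow : (A * W) ^ k = (A * W) ^ (k + 2) * (G * G) := by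
    have : (A * W) ^ 2 * (G * G) = A * W * G := by
      rw [← pow_two G]
      exact QMat.pow_mul_pow_groupInverse hc h₁ 1
    rw [pow_add, mul_assoc, this, hE]
  have hmul : QMat.adjSum ((A * W) ^ (k + 2)) r * ((A * W) ^ k * A) =
      QMat.minorSum ((A * W) ^ (k + 2)) r • (G * G * A) := by
    rw [hpow, ← Matrix.mul_assoc, ← mul_assoc, hP, Matrix.smul_mul, Matrix.smul_mul, ← mul_assoc,
      hc.eq, h₂]
  refine ⟨⟨G * G * A, (hiff _).2 rfl, fun X hX => (hiff X).1 hX⟩, ?_, fun X hX i j => ?_⟩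
  · rwa [QMat.sum_hdet_principal hM]
  · have hnum : (QMat.adjSum ((A * W) ^ (k + 2)) r).mulVec (fun s => ((A * W) ^ k * A) s j) i =
        QMat.minorSum ((A * W) ^ (k + 2)) r • (G * G * A) i j :=
      congrFun (congrFun hmul i) j
    rw [(hiff X).1 hX, QMat.sum_hdet_principal hM]
    refine Eq.trans ?_ (congrArg (· / _) ((QMat.sum_cdet_principal hM r i _).trans hnum).symm)
    rw [← Quaternion.mul_coe_eq_smul, mul_div_cancel_right₀ _ hd']
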